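/- A (one-dimensional) stochastic cellular automaton (CA) $\mathcal A=(Q,R,V,V',f)$ consists of non-empty finite sets $Q$ (states) and $R$ (random symbols), finite sets $V,V'\subset\mathbb Z$, and a local function $f:Q^{V}\times R^{V'}\to Q$. Its explicit global function $F:Q^{\mathbb Z}\times R^{\mathbb Z}\to Q^{\mathbb Z}$ is $F(c,s)_z=f\big((c_{z+v})_{v\in V},(s_{z+v'})_{v'\in V'}\big)$, with iterates $F^0(c)=c$, $F^{t+1}(c,s^1,\dots,s^{t+1})=F(F^t(c,s^1,\dots,s^t),s^{t+1})$, and its non-deterministic global function is $N_F(c)=\{F(c,s):s\in R^{\mathbb Z}\}$. $\mathcal A$ is a plain probabilistic CA (PCA) if $V'=\{0\}$. For $m,t\ge 1$ and $k\in\mathbb Z$, the rescaling $\mathcal A^{\langle m,t,k\rangle}$ is the stochastic CA with state set $Q^m$, random symbols $(R^m)^t$ and explicit global function $(c,s)\mapsto b_m\circ\sigma_k\circ F^t(b_m^{-1}(c),b_m^{-1}(s^1),\dots,b_m^{-1}(s^t))$, where $\sigma_k(c)_z=c_{z+k}$, $b_m(c)_z=(c_{mz},\dots,c_{mz+m-1})$,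 and $s^1,\dots,s^t$ are the components of $s$. If $i:Q'\to Q$ is injective and $F$ maps $i(Q')^{\mathbb Z}\times R^{\mathbb Z}$ into $i(Q')^{\mathbb Z}$, the $i$-restriction of $\mathcal A$ is the stochastic CA with states $Q'$, random symbols $R$ and explicit global function $(c,s)\mapsto I^{-1}(F(I(c),s))$, where $I$ is the cell-by-cell extension of $i$. If $\pi:Q\to Q'$ is surjective, with cell-by-cell extension $\Pi$, and $\Pi(F(c,s))$ depends only on $\Pi(c)$ and $s$, the $\pi$-projection of $\mathcal A$ is the stochastic CA with states $Q'$, random symbols $R$ and explicit global function $(\Pi(c),s)\mapsto\Pi(F(c,s))$. Write $\mathcal A_1\sqsubseteq^N\mathcal A_2$ if some $i$-restriction of $\mathcal A_2$ has the same non-deterministic global function as $\mathcal A_1$, and $\mathcal A_1\trianglelefteq^N\mathcal A_2$ if some $\pi$-projection of some $i$-restriction of $\mathcal A_2$ does. The non-deterministic injective (resp. mixed) simulation pre-order $\preceq^N_i$ (resp. $\preceq^N_m$) is defined by: $\mathcal A_1\preceq\mathcal A_2$ if there are $m_1,m_2,t_1,t_2\ge1$ and $k_1,k_2\in\mathbb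 Z$ such that $\mathcal A_1^{\langle m_1,t_1,k_1\rangle}$ is in relation $\sqsubseteq^N$ (resp. $\trianglelefteq^N$) with $\mathcal A_2^{\langle m_2,t_2,k_2\rangle}$. A stochastic CA $\mathcal U$ is $\preceq$-universal if $\mathcal A\preceq\mathcal U$ for every stochastic CA $\mathcal A$. **Theorem.** There exists a stochastic CA $\mathcal U$, which is a PCA, that is both $\preceq^N_i$-universal and $\preceq^N_m$-universal. Moreover $\mathcal U$ simulates every stochastic CA $\mathcal A$ by blocks, with no rescaling of $\mathcal A$ and no translation: there are $m,t\ge1$ (depending on $\mathcal A$) such that $\mathcal A\sqsubseteq^N\mathcal U^{\langle m,t,0\rangle}$. -/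

import Mathlib

/-- A (one-dimensional) stochastic cellular automaton with set of states `Q` and set of random
symbols `R`: two finite neighbourhoods `V, V' ⊆ ℤ` and a local transition function
`f : Q^V × R^V' → Q`. (Finiteness and non-emptiness of `Q` and `R` are required wherever such
automata are quantified over.) -/
structure SCA (Q : Type*) (R : Type*) where
  V : Finset ℤ
  V' : Finset ℤ
  f : (V → Q) → (V' → R) → Q

namespace SCA

variable {Q R Q' : Type*}

/-- Plain probabilistic cellular automata: each cell uses its own random symbol only. -/
def IsPCA (A : SCA Q R) : Prop := A.V' = {0}

/-- The explicit global function `F : Q^ℤ × R^ℤ → Q^ℤ`. -/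
def F (A : SCA Q R) (c : ℤ → Q) (s : ℤ → R) : ℤ → Q :=
  fun z => A.f (fun v => c (z + v)) (fun v' => s (z + v'))

/-- The iterates `F^t(c, s¹, …, sᵗ)` of the explicit global function. -/
def iter (A : SCA Q R) : (t : ℕ) → (ℤ → Q) → (Fin t → ℤ → R) → (ℤ → Q)
  | 0, c, _ => c
  | t + 1, c, s => A.F (A.iter t c (fun j => s j.castSucc)) (s (Fin.last t))

/-- The non-deterministic global function `c ↦ {F(c,s) : s ∈ R^ℤ}`. -/
def N (A : SCA Q R) (c : ℤ → Q) : Set (ℤ → Q) := {d | ∃ s : ℤ → R, d = A.F c s}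

/-! ### Trimming operations -/

/-- `(i(Q'))^ℤ` is `F`-stable. -/
def Stable (A : SCA Q R) (i : Q' → Q) : Prop :=
  ∀ (c : ℤ → Q) (s : ℤ → R), (∀ z, c z ∈ Set.range i) → ∀ z, A.F c s z ∈ Set.range i

theorem Stable.local [Nonempty Q'] [Nonempty R] {A : SCA Q R} {i : Q' → Q} (h : A.Stable i)
    (q : A.V → Q') (r : A.V' → R) : ∃ a, i a = A.f (fun v => i (q v)) r := by
  classical
  have := h (fun z => i (if hz : z ∈ A.V then q ⟨z, hz⟩ else Classical.arbitrary Q'))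
    (fun z => if hz : z ∈ A.V' then r ⟨z, hz⟩ else Classical.arbitrary R) (fun z => ⟨_, rfl⟩) 0
  simpa [F] using this

/-- The `i`-restriction of `A`, for `i` injective with `(i(Q'))^ℤ` stable: the local function
`i⁻¹ ∘ f ∘ i`. -/
noncomputable def restrict [Nonempty Q'] [Nonempty R] (A : SCA Q R) (i : Q' → Q)
    (_hi : Function.Injective i) (hs : A.Stable i) : SCA Q' R where
  V := A.V
  V' := A.V'
  f := fun q r => Classical.choose (hs.local q r)

theorem restrict_F [Nonempty Q'] [Nonempty R] (A : SCA Q R) (i : Q' → Q)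
    (hi : Function.Injective i) (hs : A.Stable i) (c : ℤ → Q') (s : ℤ → R) :
    i ∘ (A.restrict i hi hs).F c s = A.F (i ∘ c) s :=
  funext fun z => Classical.choose_spec (hs.local (fun v => c (z + v)) (fun v' => s (z + v')))

/-- `π` is `F`-compatible. -/
def Compatible (A : SCA Q R) (π : Q → Q') : Prop :=
  ∀ (s : ℤ → R) (c c' : ℤ → Q), π ∘ c = π ∘ c' → π ∘ A.F c s = π ∘ A.F c' s

/-- The `π`-projection of `A`, for `π` surjective and compatible. -/
noncomputable def project (A : SCA Q R) (π : Q → Q')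
    (hπ : Function.Surjective π) (_hc : A.Compatible π) : SCA Q' R where
  V := A.V
  V' := A.V'
  f := fun q r => π (A.f (fun v => Function.surjInv hπ (q v)) r)

theorem project_F (A : SCA Q R) (π : Q → Q')
    (hπ : Function.Surjective π) (hc : A.Compatible π) (c : ℤ → Q) (s : ℤ → R) :
    (A.project π hπ hc).F (π ∘ c) s = π ∘ A.F c s :=
  hc s (fun z => Function.surjInv hπ (π (c z))) c
    (funext fun z => Function.surjInv_eq hπ (π (c z)))

/-! ### Rescaling -/

/-- The translation `σ_k`. -/
def shift (k : ℤ) (c : ℤ → Q) : ℤ → Q := fun z => c (z + k)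

/-- The packing map `b_m : S^ℤ → (S^m)^ℤ`. -/
def pack (m : ℕ+) (c : ℤ → Q) : ℤ → (Fin m → Q) := fun z j => c (m * z + j)

/-- The inverse of the packing map. -/
def unpack (m : ℕ+) (c : ℤ → (Fin m → Q)) : ℤ → Q := fun z =>
  c (z / m) ⟨(z % m).toNat, by
    have h : (0 : ℤ) < m := by exact_mod_cast m.pos
    have := Int.emod_lt_of_pos z h
    have := Int.emod_nonneg z h.ne'
    omega⟩

/-- The explicit global function of the rescaling of `A` with parameters `(m, t, k)`:
`b_m ∘ σ_k ∘ F^t (b_m⁻¹(c), b_m⁻¹(s¹), …, b_m⁻¹(sᵗ))`. -/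
def rescaleF (A : SCA Q R) (m t : ℕ+) (k : ℤ) (c : ℤ → (Fin m → Q))
    (s : ℤ → (Fin t → Fin m → R)) : ℤ → (Fin m → Q) :=
  pack m (shift k (A.iter t (unpack m c) (fun j => unpack m (fun z => s z j))))

/-- The radius `ρ` of the neighbourhoods. -/
def radius (A : SCA Q R) : ℕ := (A.V ∪ A.V').sup Int.natAbs

/-- Extension of a pattern on `[-n, n]` to a configuration (in an arbitrary way outside). -/
noncomputable def extend (n : ℕ) (q : Finset.Icc (-(n : ℤ)) n → Q) : ℤ → Q := fun z =>
  if h : z ∈ Finset.Icc (-(n : ℤ)) n then q ⟨z, h⟩ else q ⟨0, by simp⟩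

/-- The rescaling `A^{⟨m,t,k⟩}` of `A`, with state set `Q^m` and random symbols `(R^m)^t`: the
stochastic CA whose explicit global function is `rescaleF` (see `rescale_F`). -/
noncomputable def rescale (A : SCA Q R) (m t : ℕ+) (k : ℤ) : SCA (Fin m → Q) (Fin t → Fin m → R) where
  V := Finset.Icc (-((t * A.radius + k.natAbs : ℕ) : ℤ)) (t * A.radius + k.natAbs : ℕ)
  V' := Finset.Icc (-((t * A.radius + k.natAbs : ℕ) : ℤ)) (t * A.radius + k.natAbs : ℕ)
  f := fun q r => A.rescaleF m t k (extend _ q) (extend _ r) 0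

theorem iter_congr (A : SCA Q R) (t : ℕ) : ∀ (c c' : ℤ → Q) (s s' : Fin t → ℤ → R) (z z' : ℤ),
    (∀ y : ℤ, y.natAbs ≤ t * A.radius → c (z + y) = c' (z' + y)) →
    (∀ j, ∀ y : ℤ, y.natAbs ≤ t * A.radius → s j (z + y) = s' j (z' + y)) →
    A.iter t c s z = A.iter t c' s' z' := by
  induction t with
  | zero => intro c c' s s' z z' h _; simpa [iter] using h 0 (by simp)
  | succ t ih =>
    intro c c' s s' z z' h h'
    have hr : (t + 1) * A.radius = t * A.radius + A.radius := by ring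
    have hV : ∀ v ∈ A.V ∪ A.V', v.natAbs ≤ A.radius := fun v hv =>
      Finset.le_sup (f := Int.natAbs) hv
    simp only [iter, F]
    congr 1
    · funext v
      have hv := hV v (Finset.mem_union_left _ v.2)
      apply ih
      · intro y hy
        simpa [add_assoc] using h (v + y) (by omega)
      · intro j y hy
        simpa [add_assoc] using h' j.castSucc (v + y) (by omega)
    · funext v
      have hv := hV v (Finset.mem_union_right _ v.2)
      exact h' _ v (by omega)

theorem unpack_extend (m : ℕ+) (n : ℕ) (c : ℤ → (Fin m → Q)) (z : ℤ) (j : Fin m) (x : ℤ)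
    (hx : x.natAbs ≤ n) :
    unpack m c (m * z + j + x) =
      unpack m (extend n (fun v => c (z + v))) (m * 0 + j + x) := by
  have hm : (0 : ℤ) < m := by exact_mod_cast m.pos
  have hj : (j : ℤ) < m := by exact_mod_cast j.2
  have e : (m * z + j + x : ℤ) = (j + x) + m * z := by ring
  have hx1 : -(n : ℤ) ≤ x := by omega
  have hx2 : x ≤ n := by omega
  have hmem : ((j : ℤ) + x) / m ∈ Finset.Icc (-(n : ℤ)) n := by
    rw [Finset.mem_Icc]
    have hn : (n : ℤ) ≤ m * n := by nlinarith
    constructor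
    · rw [Int.le_ediv_iff_mul_le hm]; nlinarith
    · refine Int.lt_add_one_iff.mp ?_
      rw [Int.ediv_lt_iff_lt_mul hm]; nlinarith
  simp only [unpack, extend, mul_zero, zero_add]
  rw [dif_pos hmem]
  simp only [e, Int.add_mul_emod_self_left, Int.add_mul_ediv_left _ _ hm.ne']
  rw [add_comm z]

theorem rescale_F (A : SCA Q R) (m t : ℕ+) (k : ℤ) : (A.rescale m t k).F = A.rescaleF m t k := by
  funext c s z j
  simp only [F, rescale, rescaleF, pack, shift]
  symm
  apply iter_congr
  · intro y hy
    have := unpack_extend m (t * A.radius + k.natAbs) c z j (k + y) (by omega)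
    simpa only [add_assoc] using this
  · intro i y hy
    have := unpack_extend m (t * A.radius + k.natAbs) (fun z => s z i) z j (k + y) (by omega)
    simp only [add_assoc] at this ⊢
    rw [this]
    congr 1
    funext w
    simp only [extend]
    split <;> rfl

/-! ### Non-deterministic local relations and simulation pre-orders -/

section

variable {Q₁ R₁ Q₂ R₂ : Type*}

/-- `A₁` is a non-deterministic subautomaton of `A₂`. -/
def NSub [Nonempty Q₁] [Nonempty R₂] (A₁ : SCA Q₁ R₁) (A₂ : SCA Q₂ R₂) : Prop :=
  ∃ (i : Q₁ → Q₂) (hi : Function.Injective i) (hs : A₂.Stable i),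
    A₁.N = (A₂.restrict i hi hs).N

end

/-- `A₁` is, non-deterministically, a projection of a restriction of `A₂`. -/
def NMix.{u₁, v₁, u₂, v₂} {Q₁ : Type u₁} {R₁ : Type v₁} {Q₂ : Type u₂} {R₂ : Type v₂}
    [Nonempty R₂] (A₁ : SCA Q₁ R₁) (A₂ : SCA Q₂ R₂) : Prop :=
  ∃ (Q' : Type u₂) (_ : Finite Q') (_ : Nonempty Q') (i : Q' → Q₂) (hi : Function.Injective i)
    (hs : A₂.Stable i) (π : Q' → Q₁) (hπ : Function.Surjective π)
    (hc : (A₂.restrict i hi hs).Compatible π),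
    A₁.N = ((A₂.restrict i hi hs).project π hπ hc).N

section

variable {Q₁ R₁ Q₂ R₂ : Type*}

/-- The non-deterministic injective simulation pre-order. -/
def NSimInj [Nonempty Q₁] [Nonempty R₂] (A₁ : SCA Q₁ R₁) (A₂ : SCA Q₂ R₂) : Prop :=
  ∃ (m₁ m₂ t₁ t₂ : ℕ+) (k₁ k₂ : ℤ), NSub (A₁.rescale m₁ t₁ k₁) (A₂.rescale m₂ t₂ k₂)

/-- The non-deterministic mixed simulation pre-order. -/
def NSimMix [Nonempty R₂] (A₁ : SCA Q₁ R₁) (A₂ : SCA Q₂ R₂) : Prop :=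
  ∃ (m₁ m₂ t₁ t₂ : ℕ+) (k₁ k₂ : ℤ), NMix (A₁.rescale m₁ t₁ k₁) (A₂.rescale m₂ t₂ k₂)

end

end SCA

/-! The simulation is built in two layers, each stated as an equality between the set of
configurations reachable from an encoding and the image of a non-deterministic global function. Such
equalities compose (`reach_mul`), and for a block encoding they yield `NSub`
(`nSub_rescale_of_reach`).

The first layer (`gather_reach`) reduces `A` to an automaton seeing only nearest neighbours: every
cell draws its random symbol, stores it in its state, lets stored contents spread one cell per step,
and finally applies `A.f`.

The second layer (`exists_univ_reach_nearest`) turns a cell of that automaton into a block of `2 *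
h` cells of `univ`. State and random symbol form a word of `2 * w` bits turning on a loop folded
into the first `w` cells. The same program, as long as a block, sits in all blocks and slides
through their heads, so it is back in place after `2 * h` steps. It contains the transition table as
a list of rows. Messages move at speed 2 and reach the next head after `h` steps, which leaves the
second half of the period for the table lookup; `h` is a multiple of `2 * w`, so a received bit
meets the bit of the same rank on the loop.

`univ` can be a PCA because random bits are drawn into the word before the word is sent: a block and
its two neighbours then use the same bits. Only sets of outcomes are compared, so decoding random
words has to be surjective, without regard to distribution. -/

namespace SCA

/-! ### Reachable sets and simulation by blocks -/

section Reach

variable {Q R : Type*}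

/-- The configurations reachable in exactly `t` steps. -/
def reach (A : SCA Q R) (t : ℕ) (c : ℤ → Q) : Set (ℤ → Q) :=
  {d | ∃ s : Fin t → ℤ → R, d = A.iter t c s}

theorem reach_zero (A : SCA Q R) (c : ℤ → Q) : A.reach 0 c = {c} := by
  ext d
  simp [reach, iter]

theorem mem_reach_succ (A : SCA Q R) (t : ℕ) (c d : ℤ → Q) :
    d ∈ A.reach (t + 1) c ↔ ∃ d' ∈ A.reach t c, d ∈ A.N d' := by
  constructor
  · rintro ⟨s, rfl⟩
    exact ⟨_, ⟨_, rfl⟩, _, rfl⟩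
  · rintro ⟨_, ⟨s, rfl⟩, s', rfl⟩
    refine ⟨Fin.snoc (α := fun _ => ℤ → R) s s', ?_⟩
    simp [iter]

theorem mem_reach_add (A : SCA Q R) (t u : ℕ) (c d : ℤ → Q) :
    d ∈ A.reach (t + u) c ↔ ∃ d' ∈ A.reach t c, d ∈ A.reach u d' := by
  induction u generalizing d with
  | zero => simp [reach_zero]
  | succ u ih =>
    rw [← add_assoc]
    simp only [mem_reach_succ, ih]
    tauto

/-- If `t` steps of `U` on encoded configurations amount to one step of `A`, then `t * k` steps
of `U` amount to `k` steps of `A`. -/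
theorem reach_mul {Q' R' : Type*} (U : SCA Q' R') (A : SCA Q R) (e : (ℤ → Q) → (ℤ → Q')) (t : ℕ)
    (h : ∀ c, U.reach t (e c) = e '' A.N c) (k : ℕ) (c : ℤ → Q) :
    U.reach (t * k) (e c) = e '' A.reach k c := by
  induction k with
  | zero => simp [reach_zero]
  | succ k ih =>
    ext d
    rw [Nat.mul_succ, mem_reach_add, ih]
    constructor
    · rintro ⟨_, ⟨d', hd', rfl⟩, hd⟩
      rw [h] at hd
      obtain ⟨d'', hd'', rfl⟩ := hd
      exact ⟨d'', (A.mem_reach_succ _ _ _).2 ⟨d', hd', hd''⟩, rfl⟩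
    · rintro ⟨d'', hd'', rfl⟩
      obtain ⟨d', hd', hd⟩ := (A.mem_reach_succ _ _ _).1 hd''
      exact ⟨_, ⟨d', hd', rfl⟩, by rw [h]; exact ⟨_, hd, rfl⟩⟩

theorem shift_zero (c : ℤ → Q) : shift 0 c = c := by
  funext z
  simp [shift]

theorem pack_unpack (m : ℕ+) (c : ℤ → Fin m → Q) : pack m (unpack m c) = c := by
  funext z j
  have hm : (0 : ℤ) < m := by exact_mod_cast m.pos
  have hj : (j : ℤ) < m := by exact_mod_cast j.2
  have h1 : ((m : ℤ) * z + j) / m = z := by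
    rw [add_comm, Int.add_mul_ediv_left _ _ hm.ne', Int.ediv_eq_zero_of_lt (by omega) hj, zero_add]
  have h2 : ((m : ℤ) * z + j) % m = j := by
    rw [add_comm, Int.add_mul_emod_self_left, Int.emod_eq_of_lt (by omega) hj]
  simp only [pack, unpack, h1, h2]
  rfl

theorem unpack_pack (m : ℕ+) (c : ℤ → Q) : unpack m (pack m c) = c := by
  funext z
  have hm : (0 : ℤ) < m := by exact_mod_cast m.pos
  have := Int.emod_nonneg z hm.ne'
  simp only [pack, unpack]
  congr 1
  rw [Int.toNat_of_nonneg this]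
  exact Int.mul_ediv_add_emod z m

/-- A block encoding under which `t` steps of `U` amount to one step of `A` yields a
non-deterministic subautomaton of a rescaling of `U`. -/
theorem nSub_rescale_of_reach {QU RU : Type*} [Nonempty RU] [Nonempty Q] (A : SCA Q R)
    (U : SCA QU RU) (m t : ℕ+) (i : Q → Fin m → QU) (hi : Function.Injective i)
    (h : ∀ c, U.reach t (unpack m (i ∘ c)) = (fun d => unpack m (i ∘ d)) '' A.N c) :
    NSub A (U.rescale m t 0) := by
  have key : ∀ c s, ∃ d ∈ A.N c, (U.rescale m t 0).F (i ∘ c) s = i ∘ d := by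
    intro c s
    have : U.iter t (unpack m (i ∘ c)) (fun j => unpack m (fun z => s z j)) ∈
        U.reach t (unpack m (i ∘ c)) := ⟨_, rfl⟩
    rw [h] at this
    obtain ⟨d, hd, e⟩ := this
    refine ⟨d, hd, ?_⟩
    rw [rescale_F, rescaleF, ← e, shift_zero, pack_unpack]
  have key' : ∀ c, ∀ d ∈ A.N c, ∃ s, (U.rescale m t 0).F (i ∘ c) s = i ∘ d := by
    intro c d hd
    have : unpack m (i ∘ d) ∈ U.reach t (unpack m (i ∘ c)) := by
      rw [h]
      exact ⟨d, hd, rfl⟩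
    obtain ⟨s, hs⟩ := this
    refine ⟨fun z j => pack m (s j) z, ?_⟩
    rw [rescale_F, rescaleF]
    have e : (fun j => unpack m (fun z => pack m (s j) z)) = s := by
      funext j
      exact unpack_pack m (s j)
    rw [e, ← hs, shift_zero, pack_unpack]
  have hs : (U.rescale m t 0).Stable i := by
    intro c s hc z
    choose c' hc' using hc
    obtain rfl : i ∘ c' = c := funext hc'
    obtain ⟨d, -, hd⟩ := key c' s
    exact ⟨d z, by rw [hd]; rfl⟩
  refine ⟨i, hi, hs, ?_⟩
  funext c
  ext d
  constructor
  · intro hd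
    obtain ⟨s, e⟩ := key' c d hd
    refine ⟨s, hi.comp_left ?_⟩
    change i ∘ d = i ∘ _
    rw [restrict_F, e]
  · rintro ⟨s, rfl⟩
    obtain ⟨d, hd, e⟩ := key c s
    rw [← restrict_F _ i hi hs] at e
    rwa [hi.comp_left e]

end Reach

/-- A restriction is its own projection along a bijective relabelling. The intermediate state set
must live in the universe of `Q₂`, where `Q₁` need not be; finiteness allows `ULift (Fin n)` in its
place. -/
theorem NSub.nMix {Q₁ R₁ Q₂ R₂ : Type*} [Finite Q₁] [Nonempty Q₁] [Nonempty R₂]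
    {A₁ : SCA Q₁ R₁} {A₂ : SCA Q₂ R₂} (h : NSub A₁ A₂) : NMix A₁ A₂ := by
  obtain ⟨i, hi, hs, hN⟩ := h
  obtain ⟨n, ⟨e₀⟩⟩ := Finite.exists_equiv_fin Q₁
  let e : ULift (Fin n) ≃ Q₁ := Equiv.ulift.trans e₀.symm
  have hne : Nonempty (ULift (Fin n)) := ⟨e.symm (Classical.arbitrary Q₁)⟩
  have hie : Function.Injective (i ∘ e) := hi.comp e.injective
  have hse : A₂.Stable (i ∘ e) := by
    intro c s hc
    have hr : Set.range (i ∘ e) = Set.range i := e.surjective.range_comp i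
    rw [hr] at hc ⊢
    exact hs c s hc
  have hF : ∀ c s, e ∘ (A₂.restrict (i ∘ e) hie hse).F c s =
      (A₂.restrict i hi hs).F (e ∘ c) s := by
    intro c s
    apply hi.comp_left
    change i ∘ _ = i ∘ _
    rw [restrict_F, ← Function.comp_assoc, restrict_F, Function.comp_assoc]
  have hc : (A₂.restrict (i ∘ e) hie hse).Compatible e := by
    intro s c c' hcc
    rw [e.injective.comp_left hcc]
  refine ⟨ULift (Fin n), inferInstance, hne, i ∘ e, hie, hse, e, e.surjective, hc, ?_⟩
  rw [hN]
  funext c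
  ext d
  obtain ⟨c', rfl⟩ : ∃ c', c = e ∘ c' := ⟨e.symm ∘ c, by funext z; simp⟩
  simp only [N, project_F, hF]

/-! ### Reduction to nearest neighbours -/

section Nearest

variable {T R : Type*}

/-- The stochastic CA in which a cell sees the states and random symbols of itself and of its two
neighbours. -/
def nearest (g : T × R → T × R → T × R → T) : SCA T R where
  V := {-1, 0, 1}
  V' := {-1, 0, 1}
  f := fun q r => g (q ⟨-1, by simp⟩, r ⟨-1, by simp⟩) (q ⟨0, by simp⟩, r ⟨0, by simp⟩)
    (q ⟨1, by simp⟩, r ⟨1, by simp⟩)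

theorem nearest_F (g : T × R → T × R → T × R → T) (c : ℤ → T) (s : ℤ → R) (z : ℤ) :
    (nearest g).F c s z = g (c (z - 1), s (z - 1)) (c z, s z) (c (z + 1), s (z + 1)) := by
  simp [nearest, F, sub_eq_add_neg]

end Nearest

section Gather

variable {Q R : Type*}

/-- A phase together with the states and random symbols collected so far from the cells at
distance at most `n`. -/
abbrev Window (Q R : Type*) (n : ℕ) : Type _ := Fin (n + 2) × (Finset.Icc (-(n : ℤ)) n → Q × R)

/-- Phase `0` draws the random symbol, the following phases collect the content of neighbouring
cells, and the last phase applies the local function of `A`. -/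
noncomputable def gatherStep (A : SCA Q R) (r₀ : R) (l x r : Window Q R A.radius × R) :
    Window Q R A.radius :=
  (x.1.1 + 1,
    if x.1.1 = 0 then fun _ => ((extend _ x.1.2 0).1, x.2)
    else if x.1.1 = Fin.last _ then
      fun _ => (A.f (fun v => (extend _ x.1.2 v).1) (fun v => (extend _ x.1.2 v).2), r₀)
    else fun i =>
      if (i : ℤ) = 0 then extend _ x.1.2 0
      else if 0 < (i : ℤ) then extend _ r.1.2 (i - 1) else extend _ l.1.2 (i + 1))

/-- The nearest-neighbour automaton simulating `A` in `A.radius + 2` steps. -/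
noncomputable def gather (A : SCA Q R) (r₀ : R) : SCA (Window Q R A.radius) R :=
  nearest (A.gatherStep r₀)

/-- The encoding of a state of `A` as a state of `A.gather r₀`. -/
def gatherInit (n : ℕ) (r₀ : R) (q : Q) : Window Q R n := (0, fun _ => (q, r₀))

theorem gatherInit_injective (n : ℕ) (r₀ : R) :
    Function.Injective (gatherInit (Q := Q) n r₀) := by
  intro q q' h
  have := congrFun (congrArg Prod.snd h) ⟨0, by simp⟩
  exact congrArg Prod.fst this

/-- The configuration of `A.gather r₀` when the cells at distance at most `j` have been
collected. -/
def gathered (n : ℕ) (u : ℤ → Q × R) (j : Fin (n + 1)) (z : ℤ) : Window Q R n :=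
  (j.succ, fun i => u (z + max (-(j : ℤ)) (min i j)))

theorem extend_const {α : Type*} (n : ℕ) (a : α) (z : ℤ) :
    extend n (fun _ => a) z = a := by
  simp [extend]

theorem extend_gathered (n : ℕ) (u : ℤ → Q × R) (j : Fin (n + 1)) (z i : ℤ)
    (hi : i ∈ Finset.Icc (-(n : ℤ)) n) :
    extend n (gathered n u j z).2 i = u (z + max (-(j : ℤ)) (min i j)) := by
  rw [extend, dif_pos hi, gathered]

theorem gather_N_init (A : SCA Q R) (r₀ : R) (c : ℤ → Q) :
    (A.gather r₀).N (gatherInit _ r₀ ∘ c) =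
      {d | ∃ s : ℤ → R, d = gathered A.radius (fun z => (c z, s z)) 0} := by
  have key : ∀ s, (A.gather r₀).F (gatherInit _ r₀ ∘ c) s =
      gathered A.radius (fun z => (c z, s z)) 0 := by
    intro s
    funext z
    rw [gather, nearest_F]
    simp [gatherStep, gatherInit, gathered, extend_const]
  simp only [N, key]

/-- Clamping at `j` makes a window constant beyond distance `j`, so the right neighbour's window
moved by one on the positive side, and the left one's on the negative side, is exactly the window
clamped at `j + 1`. Random symbols play no role here. -/
theorem gather_F_gathered (A : SCA Q R) (r₀ : R) (u : ℤ → Q × R) (j : Fin A.radius) (s : ℤ → R) :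
    (A.gather r₀).F (gathered A.radius u j.castSucc) s = gathered A.radius u j.succ := by
  funext z
  rw [gather, nearest_F]
  have h1 : j.castSucc.succ ≠ 0 := Fin.succ_ne_zero _
  have h2 : j.castSucc.succ ≠ Fin.last _ := by
    intro h
    have := congrArg Fin.val h
    simp at this
    have := j.2
    omega
  refine Prod.ext ?_ ?_
  · simp only [gatherStep, gathered]
    ext
    rw [Fin.val_add_one, if_neg h2]
    simp
  · simp only [gatherStep]
    rw [if_neg (by exact h1), if_neg (by exact h2)]
    funext i
    have hi := i.2
    have hj := j.2
    rw [Finset.mem_Icc] at hi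
    simp only [gathered, Fin.val_succ, Fin.val_castSucc]
    split_ifs with h3 h4
    · have := extend_gathered A.radius u j.castSucc z 0 (by simp)
      refine this.trans (congrArg u ?_)
      simp only [Fin.val_castSucc]
      push_cast
      omega
    · have := extend_gathered A.radius u j.castSucc (z + 1) (i - 1)
        (by rw [Finset.mem_Icc]; omega)
      refine this.trans (congrArg u ?_)
      simp only [Fin.val_castSucc]
      push_cast
      omega
    · have := extend_gathered A.radius u j.castSucc (z - 1) (i + 1)
        (by rw [Finset.mem_Icc]; omega)
      refine this.trans (congrArg u ?_)
      simp only [Fin.val_castSucc]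
      push_cast
      omega

/-- Clamping at `A.radius` does not affect the neighbourhoods of `A`. The phase wraps around to `0`
and `r₀` erases the used random symbol, so an encoding is recovered. -/
theorem gather_F_last (A : SCA Q R) (r₀ : R) (u : ℤ → Q × R) (s : ℤ → R) :
    (A.gather r₀).F (gathered A.radius u (Fin.last _)) s =
      gatherInit _ r₀ ∘ A.F (fun z => (u z).1) (fun z => (u z).2) := by
  funext z
  rw [gather, nearest_F]
  have h1 : (Fin.last A.radius).succ ≠ 0 := Fin.succ_ne_zero _
  have hV : ∀ v ∈ A.V ∪ A.V', extend A.radius (gathered A.radius u (Fin.last _) z).2 v =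
      u (z + v) := by
    intro v hv
    have : v.natAbs ≤ A.radius := Finset.le_sup (f := Int.natAbs) hv
    rw [extend_gathered _ _ _ _ _ (by rw [Finset.mem_Icc]; omega)]
    congr 1
    simp only [Fin.val_last]
    omega
  refine Prod.ext ?_ ?_
  · simp [gatherStep, gathered, gatherInit]
  · simp only [gatherStep]
    rw [if_neg (by exact h1), if_pos (by exact Fin.succ_last _)]
    funext i
    simp only [gatherInit, Function.comp_apply, F]
    congr 2
    · funext v
      rw [hV v (Finset.mem_union_left _ v.2)]
    · funext v
      rw [hV v (Finset.mem_union_right _ v.2)]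

theorem gather_reach (A : SCA Q R) (r₀ : R) (c : ℤ → Q) :
    (A.gather r₀).reach (A.radius + 2) (gatherInit _ r₀ ∘ c) =
      (fun d => gatherInit _ r₀ ∘ d) '' A.N c := by
  have hj : ∀ j (hj : j < A.radius + 1), (A.gather r₀).reach (j + 1) (gatherInit _ r₀ ∘ c) =
      {d | ∃ s : ℤ → R, d = gathered A.radius (fun z => (c z, s z)) ⟨j, hj⟩} := by
    intro j
    induction j with
    | zero =>
      intro hj
      ext d
      simp only [mem_reach_succ, reach_zero, Set.mem_singleton_iff, exists_eq_left, gather_N_init]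
      rfl
    | succ j ih =>
      intro hj
      ext d
      rw [mem_reach_succ, ih (by omega)]
      constructor
      · rintro ⟨_, ⟨s, rfl⟩, s', rfl⟩
        exact ⟨s, gather_F_gathered A r₀ _ ⟨j, by omega⟩ s'⟩
      -- Going from a set to the next one, any random configuration will do, since only phase `0`
      -- reads it.
      · rintro ⟨s, rfl⟩
        exact ⟨_, ⟨s, rfl⟩, fun _ => r₀, (gather_F_gathered A r₀ _ ⟨j, by omega⟩ _).symm⟩
  ext d
  rw [mem_reach_succ, hj A.radius (by omega)]
  constructor
  · rintro ⟨_, ⟨s, rfl⟩, s', rfl⟩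
    exact ⟨_, ⟨s, rfl⟩, (gather_F_last A r₀ (fun z => (c z, s z)) s').symm⟩
  · rintro ⟨_, ⟨s, rfl⟩, rfl⟩
    exact ⟨_, ⟨s, rfl⟩, fun _ => r₀, (gather_F_last A r₀ (fun z => (c z, s z)) _).symm⟩

end Gather

/-! ### The universal automaton -/

/-- Content of a cell of the data loop: the own bit, the bits received from the left and from the
right neighbour, and the output bit. -/
abbrev Datum : Type := Bool × Bool × Bool × Bool

/-- An instruction acts on the accumulator, the datum in front of the head, the messages travelling
to the left and to the right, and the random bit. -/
abbrev Instr : Type := Bool → Datum → Bool → Bool → Bool → Bool × Datum × Bool × Bool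

/-- The blank datum. -/
def blank : Datum := (false, false, false, false)

/-- States of the universal automaton. -/
@[ext]
structure UState where
  /-- instruction track, moving to the left at speed `1` -/
  prog : Instr
  /-- static mark of the head, which is also the left end of the data loop -/
  head : Bool
  /-- static mark of the cells of the data loop -/
  zone : Bool
  /-- static mark of the right end of the data loop -/
  wall : Bool
  /-- accumulator -/
  acc : Bool
  /-- lane of the data loop moving to the right -/
  up : Datum
  /-- lane of the data loop moving to the left -/
  down : Datum
  /-- message track, moving to the left at speed `2` -/
  msgL : Bool
  /-- message track, moving to the right at speed `2` -/
  msgR : Bool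

instance : Finite Instr :=
  have : Finite (Bool → Bool × Datum × Bool × Bool) := inferInstance
  have : Finite (Bool → Bool → Bool × Datum × Bool × Bool) := inferInstance
  have : Finite (Datum → Bool → Bool → Bool → Bool × Datum × Bool × Bool) := inferInstance
  Pi.finite

instance : Finite UState :=
  Finite.of_injective
    (fun s => (s.prog, s.head, s.zone, s.wall, s.acc, s.up, s.down, s.msgL, s.msgR)) (by
      intro s s' h
      simp only [Prod.mk.injEq] at h
      ext1 <;> tauto)

instance : Nonempty UState :=
  ⟨⟨fun a d l r _ => (a, d, l, r), false, false, false, false, blank, blank, false, false⟩⟩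

/-- The moving tracks advance (`l₂`, `l₁`, `x`, `r₁`, `r₂` are the states of the five cells
centred at the current one). -/
def UState.move (l₂ l₁ x r₁ r₂ : UState) : UState where
  prog := r₁.prog
  head := x.head
  zone := x.zone
  wall := x.wall
  acc := x.acc
  up := if x.zone then (if x.head then x.down else l₁.up) else blank
  down := if x.zone then (if x.wall then x.up else r₁.down) else blank
  msgL := r₂.msgL
  msgR := l₂.msgR

/-- The instruction is executed where there is a head. -/
def UState.exec (x : UState) (b : Bool) : UState :=
  if x.head then
    let y := x.prog x.acc x.up x.msgL x.msgR b
    { x with acc := y.1, up := y.2.1, msgL := y.2.2.1, msgR := y.2.2.2 }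
  else x

/-- The universal automaton. -/
def univ : SCA UState Bool where
  V := {-2, -1, 0, 1, 2}
  V' := {0}
  f := fun q r => (UState.move (q ⟨-2, by simp⟩) (q ⟨-1, by simp⟩) (q ⟨0, by simp⟩)
    (q ⟨1, by simp⟩) (q ⟨2, by simp⟩)).exec (r ⟨0, by simp⟩)

theorem univ_F (c : ℤ → UState) (s : ℤ → Bool) (p : ℤ) :
    univ.F c s p =
      (UState.move (c (p - 2)) (c (p - 1)) (c p) (c (p + 1)) (c (p + 2))).exec (s p) := by
  simp [univ, F, sub_eq_add_neg]

/-! ### Dynamics of the universal automaton -/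

/-- Content at time `τ` of a track of period `2 * h` moving to the right at speed `2`, initially
empty, on which `o τ z` is written at step `τ` at the position `2 * h * z`. -/
def track (h : ℕ) (o : ℕ → ℤ → Bool) (τ : ℕ) (p : ℤ) : Bool :=
  if p % (2 * h) % 2 = 0 ∧ p % (2 * h) < 2 * τ then
    o (τ - 1 - p % (2 * h) / 2).toNat (p / (2 * h)) else false

/-- The message read at step `τ` when the neighbour writes `o`. -/
def delayed (h : ℕ) (o : ℕ → Bool) (τ : ℕ) : Bool := if h ≤ τ then o (τ - h) else false

/-! ### Arithmetic of the message tracks -/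

section Track

variable (h : ℕ)

theorem mul_add_ediv_emod (hh : 0 < h) (z x : ℤ) (hx : 0 ≤ x) (hx' : x < 2 * h) :
    (2 * h * z + x) / (2 * h) = z ∧ (2 * h * z + x) % (2 * h) = x := by
  constructor
  · rw [add_comm, Int.add_mul_ediv_left _ _ (by omega), Int.ediv_eq_zero_of_lt hx hx', zero_add]
  · rw [add_comm, Int.add_mul_emod_self_left, Int.emod_eq_of_lt hx hx']

theorem exists_eq_mul_add (hh : 0 < h) (p : ℤ) : ∃ z x : ℤ, 0 ≤ x ∧ x < 2 * h ∧ p = 2 * h * z + x :=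
  ⟨p / (2 * h), p % (2 * h), Int.emod_nonneg _ (by omega), Int.emod_lt_of_pos _ (by omega),
    (Int.mul_ediv_add_emod _ _).symm⟩

theorem track_mul_add (hh : 0 < h) (o : ℕ → ℤ → Bool) (τ : ℕ) (z x : ℤ) (hx : 0 ≤ x) (hx' : x < 2 * h) :
    track h o τ (2 * h * z + x) =
      if x % 2 = 0 ∧ x < 2 * τ then o (τ - 1 - x / 2).toNat z else false := by
  obtain ⟨h1, h2⟩ := mul_add_ediv_emod h hh z x hx hx'
  simp only [track, h1, h2]

theorem track_succ_mul (hh : 0 < h) (o : ℕ → ℤ → Bool) (τ : ℕ) (z : ℤ) : track h o (τ + 1) (2 * h * z) = o τ z := by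
  have := track_mul_add h hh o (τ + 1) z 0 le_rfl (by omega)
  simp only [add_zero] at this
  rw [this, if_pos (by constructor <;> omega)]
  congr 1
  omega

/-- This cell is one hop before the head of block `z`, so its content is what that head is about to
read: it left the previous head `h` steps earlier. -/
theorem track_mul_sub (hh : 0 < h) (o : ℕ → ℤ → Bool) (τ : ℕ) (z : ℤ) :
    track h o τ (2 * h * z - 2) = delayed h (fun k => o k (z - 1)) τ := by
  have e : (2 * h * z - 2 : ℤ) = 2 * h * (z - 1) + (2 * h - 2) := by ring
  rw [e, track_mul_add h hh o τ _ _ (by omega) (by omega), delayed]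
  by_cases hτ : h ≤ τ
  · rw [if_pos (by constructor <;> omega), if_pos hτ]
    congr 1
    omega
  · rw [if_neg (by omega), if_neg hτ]

theorem track_succ (hh : 0 < h) (o : ℕ → ℤ → Bool) (τ : ℕ) (p : ℤ) (hp : p % (2 * h) ≠ 0) :
    track h o (τ + 1) p = track h o τ (p - 2) := by
  obtain ⟨z, x, hx, hx', rfl⟩ := exists_eq_mul_add h hh p
  rw [(mul_add_ediv_emod h hh z x hx hx').2] at hp
  rw [track_mul_add h hh o _ z x hx hx']
  -- Two cells back lies in the previous block, at an odd offset. Messages start at offset `0` and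
  -- hop by 2, so odd cells are always empty.
  by_cases h1 : x = 1
  · have e : (2 * h * z + x - 2 : ℤ) = 2 * h * (z - 1) + (2 * h - 1) := by rw [h1]; ring
    rw [e, track_mul_add h hh o τ _ _ (by omega) (by omega), if_neg (by omega), if_neg (by omega)]
  · have e : (2 * h * z + x - 2 : ℤ) = 2 * h * z + (x - 2) := by ring
    rw [e, track_mul_add h hh o τ _ _ (by omega) (by omega)]
    by_cases h2 : x % 2 = 0 ∧ x < 2 * ((τ + 1 : ℕ) : ℤ)
    · rw [if_pos h2, if_pos (by omega)]
      congr 1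
      omega
    · rw [if_neg h2, if_neg (by omega)]

theorem track_zero (hh : 0 < h) (o : ℕ → ℤ → Bool) (p : ℤ) : track h o 0 p = false := by
  have := Int.emod_nonneg p (b := 2 * h) (by omega)
  rw [track, if_neg (by omega)]

/-- A message lives for at most `h` steps before being overwritten at the next head, so at time `2 *
h` only the silent second half could have left anything. -/
theorem track_period (hh : 0 < h) (o : ℕ → ℤ → Bool) (ho : ∀ k z, h ≤ k → o k z = false) (p : ℤ) :
    track h o (2 * h) p = false := by
  have := Int.emod_lt_of_pos p (b := 2 * h) (by omega)
  rw [track]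
  split_ifs with h1
  · exact ho _ _ (by omega)
  · rfl

end Track

/-- The configuration of the universal automaton at time `τ`, when blocks have length `2 * h`, the
data loops have length `2 * w`, the program is `P`, the accumulators are `acc τ`, the contents of
the data loops are `D τ`, and the messages written at step `k` are `oL k` and `oR k`. -/
def config (w h : ℕ) (P : ℕ → Instr) (acc : ℕ → ℤ → Bool) (D : ℕ → ℤ → ZMod (2 * w) → Datum)
    (oL oR : ℕ → ℤ → Bool) (τ : ℕ) (p : ℤ) : UState where
  prog := P ((p + τ - 1) % (2 * h)).toNat
  head := decide (p % (2 * h) = 0)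
  zone := decide (p % (2 * h) < w)
  wall := decide (p % (2 * h) = w - 1)
  acc := if p % (2 * h) = 0 then acc τ (p / (2 * h)) else false
  up := if p % (2 * h) < w then D τ (p / (2 * h)) ((τ - 1 - p % (2 * h) : ℤ)) else blank
  down := if p % (2 * h) < w then D τ (p / (2 * h)) ((τ + p % (2 * h) : ℤ)) else blank
  msgL := track h (fun k z => oL k (-z)) τ (-p)
  msgR := track h oR τ p

theorem intCast_ne_natCast (w : ℕ) (τ : ℕ) (k : ℤ) (h1 : k ≠ τ) (h2 : k < τ + 2 * w)
    (h3 : τ < k + 2 * w) : (k : ZMod (2 * w)) ≠ (τ : ZMod (2 * w)) := by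
  intro e
  have e' : ((k : ℤ) : ZMod (2 * w)) = ((τ : ℤ) : ZMod (2 * w)) := by simpa using e
  rw [ZMod.intCast_eq_intCast_iff_dvd_sub] at e'
  push_cast at e'
  have := Int.eq_zero_of_abs_lt_dvd e' (by rw [abs_lt]; constructor <;> omega)
  omega

/-- Away from the heads all tracks just move, so a global step reduces to one equation per head
(`hP`) and to the invariance of the data not at the head (`hD`). The bound `hτ` keeps the
instruction index from wrapping around. -/
theorem config_succ (w h : ℕ) (hw : 0 < w) (hwh : w ≤ 2 * h) (hh : 0 < h) (P : ℕ → Instr)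
    (acc : ℕ → ℤ → Bool) (D : ℕ → ℤ → ZMod (2 * w) → Datum) (oL oR : ℕ → ℤ → Bool) (τ : ℕ)
    (hτ : τ < 2 * h) (s : ℤ → Bool)
    (hP : ∀ z, P τ (acc τ z) (D τ z τ) (delayed h (fun k => oL k (z + 1)) τ)
      (delayed h (fun k => oR k (z - 1)) τ) (s (2 * h * z)) =
        (acc (τ + 1) z, D (τ + 1) z τ, oL τ z, oR τ z))
    (hD : ∀ z, ∀ k : ZMod (2 * w), k ≠ τ → D (τ + 1) z k = D τ z k) :
    univ.F (config w h P acc D oL oR τ) s = config w h P acc D oL oR (τ + 1) := by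
  funext p
  rw [univ_F]
  obtain ⟨z, x, hx, hx', hp⟩ := exists_eq_mul_add h hh p
  obtain ⟨hz, hxm⟩ := mul_add_ediv_emod h hh z x hx hx'
  rw [← hp] at hz hxm
  -- Execution never touches this lane, so one computation serves cells with and without a head.
  have hdown : (UState.move (config w h P acc D oL oR τ (p - 2)) (config w h P acc D oL oR τ (p - 1))
      (config w h P acc D oL oR τ p) (config w h P acc D oL oR τ (p + 1))
      (config w h P acc D oL oR τ (p + 2))).down = (config w h P acc D oL oR (τ + 1) p).down := by
    simp only [UState.move, config, hz, hxm, decide_eq_true_eq]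
    by_cases h1 : x < w
    · rw [if_pos h1, if_pos h1, if_pos h1]
      by_cases h2 : x = w - 1
      -- The loop closes at the wall: `τ - w` and `τ + w` agree modulo `2 * w`.
      · have e : (((τ - 1 - x : ℤ)) : ZMod (2 * w)) = ((((τ + 1 : ℕ) : ℤ) + x : ℤ)) := by
          rw [ZMod.intCast_eq_intCast_iff_dvd_sub]
          exact ⟨1, by push_cast; omega⟩
        rw [if_pos h2, e, hD]
        exact intCast_ne_natCast _ _ _ (by omega) (by omega) (by omega)
      · obtain ⟨hz', hx'm⟩ := mul_add_ediv_emod h hh z (x + 1) (by omega) (by omega)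
        rw [← add_assoc, ← hp] at hz' hx'm
        rw [if_neg h2, hz', hx'm, if_pos (by omega), hD]
        · congr 2
          push_cast
          ring
        · exact intCast_ne_natCast _ _ _ (by omega) (by omega) (by omega)
    · rw [if_neg h1, if_neg h1]
  by_cases h0 : x = 0
  · have hp' : p = 2 * h * z := by rw [hp, h0, add_zero]
    have hexec := hP z
    have e1 : ((p + 1 + τ - 1) % (2 * h : ℤ)).toNat = τ := by
      have : (p + 1 + τ - 1) = 2 * h * z + (τ : ℤ) := by rw [hp']; ring
      rw [this, (mul_add_ediv_emod h hh z τ (by omega) (by omega)).2]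
      simp
    have e2 : track h (fun k z => oL k (-z)) τ (-(p + 2)) =
        delayed h (fun k => oL k (z + 1)) τ := by
      have : -(p + 2) = 2 * h * (-z) - 2 := by rw [hp']; ring
      rw [this, track_mul_sub h hh]
      congr 1
      funext k
      congr 1
      ring
    have e3 : track h oR τ (p - 2) = delayed h (fun k => oR k (z - 1)) τ := by
      rw [hp', track_mul_sub h hh]
    have e4 : track h (fun k z => oL k (-z)) (τ + 1) (-p) = oL τ z := by
      have : -p = 2 * h * (-z) := by rw [hp']; ring
      rw [this, track_succ_mul h hh, neg_neg]
    have e5 : track h oR (τ + 1) p = oR τ z := by rw [hp', track_succ_mul h hh]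
    rw [← hp'] at hexec
    have hy : ∀ X : UState, X.prog = P τ → X.acc = acc τ z → X.up = D τ z τ →
        X.msgL = delayed h (fun k => oL k (z + 1)) τ →
        X.msgR = delayed h (fun k => oR k (z - 1)) τ → X.head = true →
        X.exec (s p) = { X with acc := acc (τ + 1) z, up := D (τ + 1) z τ, msgL := oL τ z,
                                msgR := oR τ z } := by
      intro X a1 a2 a3 a4 a5 a6
      rw [UState.exec, if_pos a6, a1, a2, a3, a4, a5, hexec]
    rw [hy]
    · ext1
      · simp only [UState.move, config]
        congr 2
        push_cast
        ring_nf
      · rfl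
      · rfl
      · rfl
      · simp [config, hz, hxm, h0]
      · simp [config, hz, hxm, h0, hw.ne']
      · exact hdown
      · simp only [config, e4]
      · simp only [config, e5]
    · simp only [UState.move, config, e1]
    · simp [UState.move, config, hz, hxm, h0]
    · simp [UState.move, config, hz, hxm, h0, hw]
    · simp only [UState.move, config, e2]
    · simp only [UState.move, config, e3]
    · simp [UState.move, config, hxm, h0]
  · rw [UState.exec, if_neg (by simp [UState.move, config, hxm, h0])]
    ext1
    · simp only [UState.move, config]
      congr 2
      push_cast
      ring_nf
    · rfl
    · rfl
    · rfl
    · simp [UState.move, config, hxm, h0]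
    · obtain ⟨hz', hx'm⟩ := mul_add_ediv_emod h hh z (x - 1) (by omega) (by omega)
      rw [← add_sub_assoc, ← hp] at hz' hx'm
      simp only [UState.move, config, hz, hxm, hz', hx'm, decide_eq_true_eq, if_neg h0]
      by_cases h1 : x < w
      · rw [if_pos h1, if_pos h1, if_pos (by omega), hD]
        · congr 2
          push_cast
          ring
        · exact intCast_ne_natCast _ _ _ (by omega) (by omega) (by omega)
      · rw [if_neg h1, if_neg h1]
    · exact hdown
    · simp only [UState.move, config]
      rw [track_succ h hh, neg_add, sub_eq_add_neg]
      intro hc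
      rw [← Int.dvd_iff_emod_eq_zero, Int.dvd_neg, Int.dvd_iff_emod_eq_zero, hxm] at hc
      exact h0 hc
    · simp only [UState.move, config]
      rw [track_succ h hh _ _ _ (by rw [hxm]; exact h0)]

/-! ### Programs -/

section Run

variable (w : ℕ) (P : ℕ → Instr) (inL inR rnd : ℕ → Bool) (D₀ : ZMod (2 * w) → Datum)

/-- Accumulator and data of a single block after `τ` steps of the program `P`, given the messages
read and the random bits. -/
def run : ℕ → Bool × (ZMod (2 * w) → Datum)
  | 0 => (false, D₀)
  | τ + 1 =>
    let y := P τ (run τ).1 ((run τ).2 τ) (inL τ) (inR τ) (rnd τ)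
    (y.1, Function.update (run τ).2 τ y.2.1)

/-- A round, in which each datum is visited once. -/
theorem run_round (hw : 0 < w) (ρ : ℕ) (a : ℕ → Bool) (old new : ZMod (2 * w) → Datum)
    (h0 : run w P inL inR rnd D₀ (2 * w * ρ) = (a 0, old))
    (hstep : ∀ j < 2 * w, ∃ l r, P (2 * w * ρ + j) (a j) (old j) (inL (2 * w * ρ + j))
      (inR (2 * w * ρ + j)) (rnd (2 * w * ρ + j)) = (a (j + 1), new j, l, r))
    (j : ℕ) (hj : j ≤ 2 * w) :
    run w P inL inR rnd D₀ (2 * w * ρ + j) =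
      (a j, fun k => if k.val < j then new k else old k) := by
  have : NeZero (2 * w) := ⟨by omega⟩
  induction j with
  | zero => simpa using h0
  | succ j ih =>
    obtain ⟨l, r, h⟩ := hstep j (by omega)
    -- A round lasts one turn of the loop, so its step `j` always meets datum `j`.
    have hk : ((2 * w * ρ + j : ℕ) : ZMod (2 * w)) = (j : ZMod (2 * w)) := by
      rw [Nat.cast_add, Nat.cast_mul, ZMod.natCast_self, zero_mul, zero_add]
    have hv : (j : ZMod (2 * w)).val = j := ZMod.val_cast_of_lt (by omega)
    rw [← add_assoc, run, ih (by omega)]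
    simp only [hk, hv, lt_irrefl, if_false, h]
    congr 1
    funext k
    by_cases hkj : k = j
    · subst hkj
      simp [hv]
    · have : k.val ≠ j := by
        intro e
        exact hkj (by rw [← e, ZMod.natCast_zmod_val])
      rw [Function.update_of_ne hkj]
      congr 1
      exact propext (by omega)

theorem run_round_end (hw : 0 < w) (ρ : ℕ) (a : ℕ → Bool) (old new : ZMod (2 * w) → Datum)
    (h0 : run w P inL inR rnd D₀ (2 * w * ρ) = (a 0, old))
    (hstep : ∀ j < 2 * w, ∃ l r, P (2 * w * ρ + j) (a j) (old j) (inL (2 * w * ρ + j))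
      (inR (2 * w * ρ + j)) (rnd (2 * w * ρ + j)) = (a (j + 1), new j, l, r)) :
    run w P inL inR rnd D₀ (2 * w * (ρ + 1)) = (a (2 * w), new) := by
  have : NeZero (2 * w) := ⟨by omega⟩
  rw [mul_add, mul_one, run_round w P inL inR rnd D₀ hw ρ a old new h0 hstep _ le_rfl]
  congr 1
  funext k
  rw [if_pos (ZMod.val_lt k)]

end Run

/-- Words on the data loop. -/
abbrev Word (w : ℕ) : Type := ZMod (2 * w) → Bool

section Program

variable (w N : ℕ) (isR : ZMod (2 * w) → Bool) (row : ℕ → Word w × Word w × Word w)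
  (tf : Word w × Word w × Word w → Word w)

/-- Instruction executed in round `ρ` on the datum `k`, for a program evaluating the function `tf`
by means of a table with `N` rows: draw random bits at the positions `isR` and send the own word,
wait, receive the words of the neighbours, compare them with each row of the table and update the
output in case of equality, and finally store the output. -/
def roundInstr (ρ : ℕ) (k : ZMod (2 * w)) : Instr :=
  if ρ = 0 then fun a d _ _ b =>
    let o := if isR k then b else d.1
    (a, (o, d.2), o, o)
  else if ρ < 2 * N + 2 then fun a d _ _ _ => (a, d, false, false)
  else if ρ = 2 * N + 2 then fun a d l r _ => (a, (d.1, r, l, d.2.2.2), false, false)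
  else if ρ = 4 * N + 3 then fun _ d _ _ _ =>
    (false, (d.2.2.2, false, false, false), false, false)
  else if ρ % 2 = 1 then fun a d _ _ _ =>
    let x := row ((ρ - (2 * N + 3)) / 2)
    ((a || decide (k = 0)) && decide (d.1 = x.1 k ∧ d.2.1 = x.2.1 k ∧ d.2.2.1 = x.2.2 k), d,
      false, false)
  else fun a d _ _ _ =>
    (a, (d.1, d.2.1, d.2.2.1, d.2.2.2 || (a && tf (row ((ρ - (2 * N + 3)) / 2)) k)), false, false)

/-- The program made of the rounds `roundInstr`. -/
def program (τ : ℕ) : Instr := roundInstr w N isR row tf (τ / (2 * w)) τ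

theorem program_mul_add (hw : 0 < w) (ρ j : ℕ) (hj : j < 2 * w) :
    program w N isR row tf (2 * w * ρ + j) = roundInstr w N isR row tf ρ j := by
  have h1 : (2 * w * ρ + j) / (2 * w) = ρ := by
    rw [Nat.mul_add_div (by omega), Nat.div_eq_of_lt hj, add_zero]
  rw [program, h1, Nat.cast_add, Nat.cast_mul, ZMod.natCast_self, zero_mul, zero_add]

/-- Only the first round sends messages. -/
theorem program_silent (hw : 0 < w) (τ : ℕ) (hτ : 2 * w ≤ τ) (a : Bool) (d : Datum)
    (l r b : Bool) : (program w N isR row tf τ a d l r b).2.2 = (false, false) := by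
  have : τ / (2 * w) ≠ 0 := by
    have := (Nat.le_div_iff_mul_le (by omega : 0 < 2 * w)).2 (by simpa using hτ : 1 * (2 * w) ≤ τ)
    omega
  rw [program, roundInstr, if_neg this]
  split_ifs <;> rfl

/-- The word of a block once its random bits have been drawn. -/
def drawn (x : Word w) (rnd : ℕ → Bool) : Word w :=
  fun k => if isR k then rnd k.val else x k

/-- The messages sent by a block whose word is `y`. -/
def sent (y : Word w) (τ : ℕ) : Bool := if τ < 2 * w then y τ else false

variable (inL inR rnd : ℕ → Bool) (x yl yr : Word w)

/-- The content of the data loop of a block with word `x`. -/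
def load (x : Word w) : ZMod (2 * w) → Datum := fun k => (x k, false, false, false)

theorem run_first_step (hw : 0 < w) (j : ℕ) (hj : j < 2 * w) (a : Bool) :
    program w N isR row tf (2 * w * 0 + j) a (load w x j) (inL (2 * w * 0 + j))
      (inR (2 * w * 0 + j)) (rnd (2 * w * 0 + j)) =
    (a, load w (drawn w isR x rnd) j, drawn w isR x rnd j, drawn w isR x rnd j) := by
  have hv : (j : ZMod (2 * w)).val = j := ZMod.val_cast_of_lt hj
  rw [program_mul_add w N isR row tf hw 0 j hj, roundInstr, if_pos rfl]
  simp [load, drawn, hv]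

/-- What a block sends depends on its own word and draw, never on what it receives. Hence all
messages can be written down before any block is run. -/
theorem program_messages (hw : 0 < w) (τ : ℕ) :
    (program w N isR row tf τ (run w (program w N isR row tf) inL inR rnd (load w x) τ).1
      ((run w (program w N isR row tf) inL inR rnd (load w x) τ).2 τ) (inL τ) (inR τ) (rnd τ)).2.2 =
    (sent w (drawn w isR x rnd) τ, sent w (drawn w isR x rnd) τ) := by
  by_cases hτ : τ < 2 * w
  · have hv : (τ : ZMod (2 * w)).val = τ := ZMod.val_cast_of_lt hτ
    have h := run_round w (program w N isR row tf) inL inR rnd (load w x) hw 0 (fun _ => false)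
      (load w x) (load w (drawn w isR x rnd)) rfl
      (fun j hj => ⟨_, _, run_first_step w N isR row tf inL inR rnd x hw j hj _⟩) τ hτ.le
    have h' := run_first_step w N isR row tf inL inR rnd x hw τ hτ false
    simp only [mul_zero, zero_add] at h h'
    rw [h]
    simp only [hv, lt_irrefl, if_false]
    rw [h', sent, if_pos hτ]
  · rw [program_silent w N isR row tf hw τ (by omega), sent, if_neg hτ]

variable {inL inR}

theorem run_waiting (hw : 0 < w) (ρ : ℕ) (hρ : ρ < 2 * N + 2) :
    run w (program w N isR row tf) inL inR rnd (load w x) (2 * w * (ρ + 1)) =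
      (false, load w (drawn w isR x rnd)) := by
  induction ρ with
  | zero =>
    exact run_round_end w _ inL inR rnd (load w x) hw 0 (fun _ => false) (load w x) _ rfl
      (fun j hj => ⟨_, _, run_first_step w N isR row tf inL inR rnd x hw j hj _⟩)
  | succ ρ ih =>
    refine run_round_end w _ inL inR rnd _ hw (ρ + 1) (fun _ => false) _ _ (ih (by omega)) ?_
    intro j hj
    rw [program_mul_add w N isR row tf hw _ j hj, roundInstr, if_neg (by omega), if_pos hρ]
    exact ⟨_, _, rfl⟩

/-- Messages moving left come from the right neighbour, so `inL` carries `yr` and `inR` carries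
`yl`. -/
theorem run_received (hw : 0 < w)
    (hL : ∀ j < 2 * w, inL (2 * w * (2 * N + 2) + j) = yr j)
    (hR : ∀ j < 2 * w, inR (2 * w * (2 * N + 2) + j) = yl j) :
    run w (program w N isR row tf) inL inR rnd (load w x) (2 * w * (2 * N + 3)) =
      (false, fun k => (drawn w isR x rnd k, yl k, yr k, false)) := by
  refine run_round_end w _ inL inR rnd _ hw (2 * N + 2) (fun _ => false) _ _
    (run_waiting w N isR row tf rnd x hw (2 * N + 1) (by omega)) ?_
  intro j hj
  rw [program_mul_add w N isR row tf hw _ j hj, roundInstr, if_neg (by omega), if_neg (by omega),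
    if_pos rfl, hL j hj, hR j hj]
  exact ⟨_, _, rfl⟩

/-- Each row costs two rounds: a test leaving its verdict in the accumulator, then a disjunction
into the output. The accumulator is left unspecified because the next test discards it at datum `0`.
-/
theorem run_rows (hw : 0 < w)
    (hL : ∀ j < 2 * w, inL (2 * w * (2 * N + 2) + j) = yr j)
    (hR : ∀ j < 2 * w, inR (2 * w * (2 * N + 2) + j) = yl j) (i : ℕ) (hi : i ≤ N) :
    ∃ (a : Bool) (out : Word w),
      run w (program w N isR row tf) inL inR rnd (load w x) (2 * w * (2 * N + 3 + 2 * i)) =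
        (a, fun k => (drawn w isR x rnd k, yl k, yr k, out k)) ∧
      ∀ k, out k = true ↔
        ∃ i' < i, row i' = (drawn w isR x rnd, yl, yr) ∧ tf (row i') k = true := by
  classical
  have : NeZero (2 * w) := ⟨by omega⟩
  induction i with
  | zero =>
    refine ⟨false, fun _ => false, ?_, by simp⟩
    simpa using run_received w N isR row tf rnd x yl yr hw hL hR
  | succ i ih =>
    obtain ⟨a₀, out, ih, hout⟩ := ih (by omega)
    set y := drawn w isR x rnd
    -- Before the first step the accumulator is the stale `a₀`; afterwards it says whether the data
    -- visited so far agree with the row.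
    have htest := run_round_end w _ inL inR rnd _ hw (2 * N + 3 + 2 * i)
      (fun j => if j = 0 then a₀ else decide (∀ k : ZMod (2 * w), k.val < j →
        y k = (row i).1 k ∧ yl k = (row i).2.1 k ∧ yr k = (row i).2.2 k)) _
      (fun k => (y k, yl k, yr k, out k)) ih (by
        intro j hj
        have hv : (j : ZMod (2 * w)).val = j := ZMod.val_cast_of_lt hj
        have e : (2 * N + 3 + 2 * i - (2 * N + 3)) / 2 = i := by omega
        rw [program_mul_add w N isR row tf hw _ j hj, roundInstr, if_neg (by omega),
          if_neg (by omega), if_neg (by omega), if_neg (by omega), if_pos (by omega), e]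
        refine ⟨false, false, ?_⟩
        refine Prod.ext ?_ rfl
        have hstep : (∀ k : ZMod (2 * w), k.val < j + 1 →
            y k = (row i).1 k ∧ yl k = (row i).2.1 k ∧ yr k = (row i).2.2 k) ↔
            (∀ k : ZMod (2 * w), k.val < j →
              y k = (row i).1 k ∧ yl k = (row i).2.1 k ∧ yr k = (row i).2.2 k) ∧
            (y j = (row i).1 j ∧ yl j = (row i).2.1 j ∧ yr j = (row i).2.2 j) := by
          constructor
          · intro h
            exact ⟨fun k hk => h k (by omega), h j (by omega)⟩
          · rintro ⟨h1, h2⟩ k hk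
            rcases Nat.lt_succ_iff_lt_or_eq.1 hk with hk | hk
            · exact h1 k hk
            · have : k = j := by rw [← hk, ZMod.natCast_zmod_val]
              rw [this]
              exact h2
        by_cases hj0 : j = 0
        · subst hj0
          simp
        · have : (j : ZMod (2 * w)) ≠ 0 := by
            intro h
            rw [h, ZMod.val_zero] at hv
            exact hj0 hv.symm
          simp only [this, hstep, hj0, decide_false, Bool.or_false, if_false, Nat.succ_ne_zero,
            Bool.decide_and])
    have hmatch : (∀ k : ZMod (2 * w), k.val < 2 * w →
        y k = (row i).1 k ∧ yl k = (row i).2.1 k ∧ yr k = (row i).2.2 k) ↔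
        row i = (y, yl, yr) := by
      constructor
      · intro h
        refine Prod.ext ?_ (Prod.ext ?_ ?_) <;> funext k
        · exact (h k (ZMod.val_lt k)).1.symm
        · exact (h k (ZMod.val_lt k)).2.1.symm
        · exact (h k (ZMod.val_lt k)).2.2.symm
      · intro h k _
        simp [h]
    simp only [hmatch, show 2 * w ≠ 0 by omega, if_false] at htest
    refine ⟨decide (row i = (y, yl, yr)),
      fun k => out k || (decide (row i = (y, yl, yr)) && tf (row i) k), ?_, ?_⟩
    · have e : 2 * N + 3 + 2 * (i + 1) = 2 * N + 3 + 2 * i + 1 + 1 := by ring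
      rw [e]
      refine run_round_end w _ inL inR rnd _ hw (2 * N + 3 + 2 * i + 1)
        (fun _ => decide (row i = (y, yl, yr))) _ _ htest ?_
      intro j hj
      have e : (2 * N + 3 + 2 * i + 1 - (2 * N + 3)) / 2 = i := by omega
      rw [program_mul_add w N isR row tf hw _ j hj, roundInstr, if_neg (by omega),
        if_neg (by omega), if_neg (by omega), if_neg (by omega), if_neg (by omega), e]
      exact ⟨_, _, rfl⟩
    · intro k
      simp only [Bool.or_eq_true, Bool.and_eq_true, decide_eq_true_eq, hout,
        Nat.lt_succ_iff_lt_or_eq, or_and_right, exists_or, exists_eq_left]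

/-- The table contains the actual triple, and every row equal to it contributes the same value, so
repeated rows are harmless. -/
theorem run_program (hw : 0 < w) (hrow : ∀ v, ∃ i < N, row i = v)
    (hL : ∀ j < 2 * w, inL (2 * w * (2 * N + 2) + j) = yr j)
    (hR : ∀ j < 2 * w, inR (2 * w * (2 * N + 2) + j) = yl j) :
    run w (program w N isR row tf) inL inR rnd (load w x) (2 * (2 * w * (2 * N + 2))) =
      (false, load w (tf (drawn w isR x rnd, yl, yr))) := by
  obtain ⟨a, out, h, hout⟩ := run_rows w N isR row tf rnd x yl yr hw hL hR N le_rfl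
  -- The period consists of `4 * N + 4` rounds; the last one, numbered `4 * N + 3`, stores the
  -- output and clears the accumulator.
  have e : 2 * (2 * w * (2 * N + 2)) = 2 * w * (2 * N + 3 + 2 * N + 1) := by ring
  rw [e]
  refine (run_round_end w _ inL inR rnd _ hw (2 * N + 3 + 2 * N)
    (fun j => if j = 0 then a else false) _ (load w (tf (drawn w isR x rnd, yl, yr))) h ?_).trans ?_
  · intro j hj
    rw [program_mul_add w N isR row tf hw _ j hj, roundInstr, if_neg (by omega),
      if_neg (by omega), if_neg (by omega), if_pos (by omega)]
    refine ⟨false, false, ?_⟩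
    simp only [Nat.succ_ne_zero, if_false, load, Prod.mk.injEq, true_and, and_true]
    rw [Bool.eq_iff_iff, hout]
    constructor
    · rintro ⟨i, -, h1, h2⟩
      rwa [h1] at h2
    · intro h1
      obtain ⟨i, hi, hi'⟩ := hrow (drawn w isR x rnd, yl, yr)
      exact ⟨i, hi, hi', by rwa [hi']⟩
  · rw [if_neg (by omega)]

end Program

/-! ### Universality -/

section Encode

variable (w h : ℕ) (P : ℕ → Instr)

/-- The state of the cell `x` of a block of length `2 * h` containing the program `P` and the word
`v`. -/
def blockState (v : Word w) (x : ℤ) : UState where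
  prog := P ((x - 1) % (2 * h)).toNat
  head := decide (x = 0)
  zone := decide (x < w)
  wall := decide (x = w - 1)
  acc := false
  up := if x < w then load w v ((-1 - x : ℤ)) else blank
  down := if x < w then load w v (x : ℤ) else blank
  msgL := false
  msgR := false

/-- The lower half of the word is readable on the lane `down`, the upper half, in reverse order, on
the lane `up`. -/
theorem blockState_injective (hw : 0 < w) (hwh : w ≤ 2 * h) (m : ℕ) (hm : m = 2 * h) :
    Function.Injective (fun (v : Word w) (j : Fin m) => blockState w h P v j) := by
  have : NeZero (2 * w) := ⟨by omega⟩
  intro v v' hv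
  funext k
  have hk := ZMod.val_lt k
  by_cases hkw : k.val < w
  · have := congrArg UState.down (congrFun hv ⟨k.val, by omega⟩)
    simp only [blockState, Nat.cast_lt, hkw, if_true, load, Prod.mk.injEq, and_true,
      Int.cast_natCast, ZMod.natCast_zmod_val] at this
    exact this
  · have := congrArg UState.up (congrFun hv ⟨2 * w - 1 - k.val, by omega⟩)
    have e : ((-1 - ((2 * w - 1 - k.val : ℕ) : ℤ) : ℤ) : ZMod (2 * w)) = k := by
      have : (-1 - ((2 * w - 1 - k.val : ℕ) : ℤ) : ℤ) = (k.val : ℤ) - ((2 * w : ℕ) : ℤ) := by omega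
      rw [this, Int.cast_sub, Int.cast_natCast, Int.cast_natCast, ZMod.natCast_self,
        ZMod.natCast_zmod_val, sub_zero]
    simp only [blockState, Nat.cast_lt, show 2 * w - 1 - k.val < w by omega, if_true, load, e,
      Prod.mk.injEq, and_true] at this
    exact this

/-- The configuration in which the block `z` contains the program `P` and the word `x z`. -/
def blocks (x : ℤ → Word w) (p : ℤ) : UState := blockState w h P (x (p / (2 * h))) (p % (2 * h))

/-- Divisibility by `2 * h` realigns the program and divisibility by `2 * w` realigns the loops. It
serves at both ends of the period, `τ = 0` and `τ = 2 * h`. -/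
theorem config_eq_blocks (acc : ℕ → ℤ → Bool) (D : ℕ → ℤ → ZMod (2 * w) → Datum)
    (oL oR : ℕ → ℤ → Bool) (τ : ℕ) (x : ℤ → Word w) (hτ : 2 * h ∣ τ) (hwτ : 2 * w ∣ τ)
    (hacc : ∀ z, acc τ z = false) (hD : ∀ z, D τ z = load w (x z))
    (hL : ∀ p, track h (fun k z => oL k (-z)) τ p = false) (hR : ∀ p, track h oR τ p = false) :
    config w h P acc D oL oR τ = blocks w h P x := by
  funext p
  have hτ' : (τ : ZMod (2 * w)) = 0 := (ZMod.natCast_eq_zero_iff _ _).2 hwτ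
  have hp : (p + τ - 1) % (2 * h : ℤ) = (p % (2 * h) - 1) % (2 * h) := by
    obtain ⟨q, rfl⟩ := hτ
    push_cast
    have : (p + 2 * h * q - 1 : ℤ) = (p - 1) + 2 * h * q := by ring
    rw [this, Int.add_mul_emod_self_left, Int.emod_sub_emod]
  simp [config, blocks, blockState, hacc, hD, hL, hR, hp, hτ']

theorem unpack_blocks {T : Type*} (m : ℕ+) (hm : (m : ℕ) = 2 * h) (v : T → Word w) (c : ℤ → T) :
    unpack m ((fun t (j : Fin m) => blockState w h P (v t) j) ∘ c) =
      blocks w h P (fun z => v (c z)) := by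
  funext p
  have hm' : (m : ℤ) = 2 * h := by exact_mod_cast hm
  have := Int.emod_nonneg p (b := m) (by have := m.pos; omega)
  simp only [unpack, blocks, Function.comp_apply, Int.toNat_of_nonneg this]
  rw [hm']

end Encode

theorem univ_iter_program (w N : ℕ) (hw : 0 < w) (isR : ZMod (2 * w) → Bool)
    (row : ℕ → Word w × Word w × Word w) (hrow : ∀ v, ∃ i < N, row i = v)
    (tf : Word w × Word w × Word w → Word w) (h : ℕ) (hh : h = 2 * w * (2 * N + 2))
    (S : ℕ → ℤ → Bool) (x y : ℤ → Word w)
    (hy : ∀ z, y z = drawn w isR (x z) (fun τ => S τ (2 * h * z))) :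
    univ.iter (2 * h) (blocks w h (program w N isR row tf) x) (fun j => S j) =
      blocks w h (program w N isR row tf) (fun z => tf (y z, y (z - 1), y (z + 1))) := by
  set P := program w N isR row tf with hPdef
  have hwh : 2 * w ≤ h := by
    rw [hh]
    exact Nat.le_mul_of_pos_right _ (by omega)
  have hh0 : 0 < h := by omega
  -- The drawn words `y` determine all messages, so the blocks can be run separately, without mutual
  -- recursion.
  let inL : ℤ → ℕ → Bool := fun z => delayed h (sent w (y (z + 1)))
  let inR : ℤ → ℕ → Bool := fun z => delayed h (sent w (y (z - 1)))
  let st : ℤ → ℕ → Bool × (ZMod (2 * w) → Datum) := fun z =>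
    run w P (inL z) (inR z) (fun τ => S τ (2 * h * z)) (load w (x z))
  let o : ℕ → ℤ → Bool := fun τ z => sent w (y z) τ
  let cfg := config w h P (fun τ z => (st z τ).1) (fun τ z => (st z τ).2) o o
  have hiter : ∀ τ ≤ 2 * h, univ.iter τ (cfg 0) (fun j => S j) = cfg τ := by
    intro τ
    induction τ with
    | zero => intro _; rfl
    | succ τ ih =>
      intro hτ
      have h1 := ih (by omega)
      simp only [iter, Fin.val_castSucc, Fin.val_last]
      rw [h1]
      refine config_succ w h hw (by omega) hh0 P _ _ _ _ τ (by omega) _ ?_ ?_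
      · intro z
        have h2 := program_messages w N isR row tf (inL z) (inR z) (fun τ => S τ (2 * h * z))
          (x z) hw τ
        rw [← hy z] at h2
        refine Prod.ext rfl (Prod.ext ?_ h2)
        simp only [st, run, Function.update_self]
        rfl
      · intro z k hk
        simp only [st, run, Function.update_of_ne hk]
  have h0 : cfg 0 = blocks w h P x :=
    config_eq_blocks w h P _ _ _ _ 0 x (dvd_zero _) (dvd_zero _) (fun _ => rfl) (fun _ => rfl)
      (track_zero h hh0 _) (track_zero h hh0 _)
  have hsilent : ∀ k z, h ≤ k → o k z = false := by
    intro k z hk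
    simp only [o, sent]
    rw [if_neg (by omega)]
  have hin : ∀ (v : Word w), ∀ j < 2 * w, delayed h (sent w v) (2 * w * (2 * N + 2) + j) = v j := by
    intro v j hj
    rw [← hh, delayed, if_pos (by omega), Nat.add_sub_cancel_left, sent, if_pos hj]
  have hend : ∀ z, st z (2 * h) = (false, load w (tf (y z, y (z - 1), y (z + 1)))) := by
    intro z
    have := run_program w N isR row tf (inL := inL z) (inR := inR z) (fun τ => S τ (2 * h * z))
      (x z) (y (z - 1)) (y (z + 1)) hw hrow (hin _) (hin _)
    rwa [← hy z, ← hh] at this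
  rw [← h0, hiter _ le_rfl]
  refine config_eq_blocks w h P _ _ _ _ _ _ dvd_rfl ?_ ?_ ?_ ?_ ?_
  · exact Dvd.dvd.mul_left (hh ▸ Dvd.intro _ rfl) _
  · intro z
    rw [hend]
  · intro z
    rw [hend]
  · exact track_period h hh0 _ fun k z hk => hsilent k _ hk
  · exact track_period h hh0 _ hsilent

/-- Every nearest-neighbour automaton is simulated by the universal automaton. -/
theorem exists_univ_reach_nearest {T R : Type*} [Finite T] [Nonempty T] [Finite R] [Nonempty R]
    (g : T × R → T × R → T × R → T) :
    ∃ (m : ℕ+) (i : T → Fin m → UState), Function.Injective i ∧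
      ∀ c, univ.reach m (unpack m (i ∘ c)) =
        (fun d => unpack m (i ∘ d)) '' (nearest g).N c := by
  classical
  -- The first `w` bits of a word will code a state, the last `w` a random symbol.
  obtain ⟨w, hw, ⟨eT⟩, ⟨eR⟩⟩ : ∃ w : ℕ, 0 < w ∧ Nonempty (T ↪ (Fin w → Bool)) ∧
      Nonempty (R ↪ (Fin w → Bool)) := by
    have := Fintype.ofFinite T
    have := Fintype.ofFinite R
    have hlt := Nat.lt_two_pow_self (n := Fintype.card T + Fintype.card R)
    have hT : 0 < Fintype.card T := Fintype.card_pos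
    refine ⟨Fintype.card T + Fintype.card R, by omega, ?_, ?_⟩ <;>
    · apply Function.Embedding.nonempty_of_card_le
      simp
      omega
  have hw2 : NeZero (2 * w) := ⟨by omega⟩
  let isR : ZMod (2 * w) → Bool := fun k => decide (w ≤ k.val)
  let word : T → Word w := fun t k => if hk : k.val < w then eT t ⟨k.val, hk⟩ else false
  have hword : Function.Injective word := by
    intro t t' ht
    apply eT.injective
    funext j
    have := congrFun ht ((j : ℕ) : ZMod (2 * w))
    have hv : ((j : ℕ) : ZMod (2 * w)).val = j := ZMod.val_cast_of_lt (by omega)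
    simpa [word, hv] using this
  -- The random half is zeroed first, so that leftover drawn bits do not affect the decoded state.
  -- Bit strings that code nothing decode to arbitrary values.
  let decT : Word w → T := fun y => Function.invFun word (fun k => if isR k then false else y k)
  let decR : Word w → R := fun y =>
    Function.invFun eR (fun j => y ((w + j : ℕ) : ZMod (2 * w)))
  have hdecT : ∀ t rnd, decT (drawn w isR (word t) rnd) = t := by
    intro t rnd
    have : (fun k => if isR k then false else drawn w isR (word t) rnd k) = word t := by
      funext k
      by_cases hk : w ≤ k.val
      · simp [isR, word, hk]
      · simp [isR, drawn, hk]
    simp only [decT, this]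
    exact Function.leftInverse_invFun hword t
  let tf : Word w × Word w × Word w → Word w := fun v =>
    word (g (decT v.2.1, decR v.2.1) (decT v.1, decR v.1) (decT v.2.2, decR v.2.2))
  obtain ⟨N, ⟨e⟩⟩ := Finite.exists_equiv_fin (Word w × Word w × Word w)
  let row : ℕ → Word w × Word w × Word w := fun i =>
    if hi : i < N then e.symm ⟨i, hi⟩ else Classical.arbitrary _
  have hrow : ∀ v, ∃ i < N, row i = v := fun v => ⟨e v, (e v).2, by simp [row]⟩
  obtain ⟨h, hh⟩ : ∃ h, h = 2 * w * (2 * N + 2) := ⟨_, rfl⟩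
  have hwh : 2 * w ≤ h := by
    rw [hh]
    exact Nat.le_mul_of_pos_right _ (by omega)
  let m : ℕ+ := ⟨2 * h, by omega⟩
  have hm : (m : ℕ) = 2 * h := rfl
  let i : T → Fin m → UState := fun t j => blockState w h (program w N isR row tf) (word t) j
  have hi : Function.Injective i :=
    (blockState_injective w h (program w N isR row tf) hw (by omega) m hm).comp hword
  have hstep : ∀ (c : ℤ → T) (S : ℕ → ℤ → Bool),
      univ.iter m (unpack m (i ∘ c)) (fun j => S j) = unpack m (i ∘ (nearest g).F c
        (fun z => decR (drawn w isR (word (c z)) (fun τ => S τ (2 * h * z))))) := by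
    intro c S
    rw [unpack_blocks w h _ m hm word c, unpack_blocks w h _ m hm word]
    refine (univ_iter_program w N hw isR row hrow tf h hh S (fun z => word (c z)) _
      (fun z => rfl)).trans ?_
    congr 1
    funext z
    simp only [tf, hdecT, nearest_F]
  refine ⟨m, i, hi, fun c => ?_⟩
  ext d
  constructor
  · rintro ⟨s, rfl⟩
    have := hstep c (fun τ => if hτ : τ < m then s ⟨τ, hτ⟩ else fun _ => false)
    simp only [Fin.is_lt, dif_pos] at this
    exact ⟨_, ⟨_, rfl⟩, this.symm⟩
  · rintro ⟨_, ⟨s, rfl⟩, rfl⟩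
    -- Steps `w` to `2 * w - 1` supply the code of the wanted symbol. For `τ < w` the truncated
    -- subtraction gives a junk bit, which is not drawn since `isR` is false there.
    let S : ℕ → ℤ → Bool := fun τ p =>
      if hτ : τ - w < w then eR (s (p / (2 * h))) ⟨τ - w, hτ⟩ else false
    refine ⟨fun j => S j, ?_⟩
    rw [hstep]
    simp only
    congr 3
    funext z
    have hz : (2 * h * z : ℤ) / (2 * h) = z := Int.mul_ediv_cancel_left _ (by omega)
    have : (fun j : Fin w => drawn w isR (word (c z)) (fun τ => S τ (2 * h * z))
        ((w + j : ℕ) : ZMod (2 * w))) = eR (s z) := by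
      funext j
      have hv : ((w + j : ℕ) : ZMod (2 * w)).val = w + j := ZMod.val_cast_of_lt (by omega)
      simp only [drawn, isR, hv, S, hz]
      simp
    simp only [decR, this]
    exact (Function.leftInverse_invFun eR.injective (s z)).symm

/-- Every stochastic CA is simulated by the universal automaton by blocks. -/
theorem exists_nSub_univ {Q R : Type*} [Finite Q] [Nonempty Q] [Finite R] [Nonempty R]
    (A : SCA Q R) : ∃ m t : ℕ+, NSub A (univ.rescale m t 0) := by
  let r₀ : R := Classical.arbitrary R
  obtain ⟨m, i, hi, h⟩ := exists_univ_reach_nearest (A.gatherStep r₀)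
  refine ⟨m, m * ⟨A.radius + 2, by omega⟩, nSub_rescale_of_reach A univ m _
    (i ∘ gatherInit A.radius r₀) (hi.comp (gatherInit_injective _ r₀)) fun c => ?_⟩
  have := reach_mul univ (A.gather r₀) (fun d => unpack m (i ∘ d)) m h (A.radius + 2)
    (gatherInit A.radius r₀ ∘ c)
  rw [gather_reach, Set.image_image] at this
  exact this

end SCA

theorem theorem5 :
    ∃ (QU RU : Type) (_ : Finite QU) (_ : Nonempty QU) (_ : Finite RU) (_ : Nonempty RU)
      (U : SCA QU RU), U.IsPCA ∧
      ∀ (Q : Type*) (R : Type*) [Finite Q] [Nonempty Q] [Finite R] [Nonempty R] (A : SCA Q R),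
        SCA.NSimInj A U ∧ SCA.NSimMix A U ∧
        -- block simulation, without rescaling of `A` and without translation
        ∃ m t : ℕ+, SCA.NSub A (U.rescale m t 0) := by
  refine ⟨SCA.UState, Bool, inferInstance, inferInstance, inferInstance, inferInstance, SCA.univ,
    rfl, ?_⟩
  intro Q R _ _ _ _ A
  -- The trivial rescaling of `A` is itself a stochastic CA, so block simulation applies to it
  -- directly and gives both pre-orders without comparing it to `A`.
  obtain ⟨m, t, h⟩ := SCA.exists_nSub_univ (A.rescale 1 1 0)
  exact ⟨⟨1, m, 1, t, 0, 0, h⟩, ⟨1, m, 1, t, 0, 0, h.nMix⟩, SCA.exists_nSub_univ A⟩
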